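/- Let $X_1,X_2,\dots$ be independent $\mathcal N(\mu,\sigma^2)$ random variables on a probability space, $\mu\in\mathbb R$, $\sigma>0$, and let $T>0$ and $M\in\mathbb N$ be fixed. For $n\ge 1$ put \[ \bar X=\frac1n\sum_{k=1}^nX_k,\qquad S_X^2=\frac1n\sum_{k=1}^n(X_k-\bar X)^2,\qquad \widehat\psi_X(t)=\frac1n\sum_{k=1}^n e^{itX_k}, \] and let $\widehat\psi_X^*(t)=\exp(-it\bar X/S_X)\,\widehat\psi_X(t/S_X)$ be the standardized empirical characteristic function, with $\widehat\psi_X^*\equiv 1$ if $S_X=0$ (for $n\ge2$ this happens with probability $0$). Let $\psi_0(t)=e^{-t^2/2}$ and, for $m\ge1$ and $t\in\mathbb R$, \[ S_m^{(n)}(t)=\bigl(\widehat\psi_X^*(t/\sqrt m)\bigr)^m,\qquad D_m^{(n)}=S_{m+1}^{(n)}-S_m^{(n)},\qquad U_n(t)=\sqrt n\,\bigl(\widehat\psi_X^*(t)-\psi_0(t)\bigr), \] \[ H_m^{(n)}(t)=(m+1)\frac{U_n(t/\sqrt{m+1})}{\psi_0(t/\sqrt{m+1})}-m\,\frac{U_n(t/\sqrt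 m)}{\psi_0(t/\sqrt m)}. \] Let $\|f\|_\infty=\sup_{t\in[-T,T]}|f(t)|$. Then for each $m\in\{1,\dots,M\}$ there exist random elements $r_m^{(n)}$ of $C([-T,T];\mathbb C)$ such that, for all $n\ge1$, \[ D_m^{(n)}(t)=\frac{\psi_0(t)}{\sqrt n}H_m^{(n)}(t)+r_m^{(n)}(t),\qquad t\in[-T,T], \] where $\|r_m^{(n)}\|_\infty=o_{\mathbb P}(n^{-1/2})$ as $n\to\infty$ and, for every real $p\ge1$, the family $\{\|r_m^{(n)}\|_\infty^p:n\ge1\}$ is uniformly integrable. Moreover, $\|D_m^{(n)}\|_\infty=O_{\mathbb P}(n^{-1/2})$ as $n\to\infty$. -/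

import Mathlib

open MeasureTheory ProbabilityTheory Filter Topology

namespace SelfSimilarityTest

noncomputable section

/-- The sample mean `x̄ = (1/n) ∑ x_k`. -/
def sampleMean {n : ℕ} (x : Fin n → ℝ) : ℝ :=
  (∑ k, x k) / n

/-- The sample variance `S² = (1/n) ∑ (x_k - x̄)²`, normalized by `1/n`. -/
def sampleVar {n : ℕ} (x : Fin n → ℝ) : ℝ :=
  (∑ k, (x k - sampleMean x) ^ 2) / n

/-- The sample standard deviation `S`. -/
def sampleSD {n : ℕ} (x : Fin n → ℝ) : ℝ :=
  √(sampleVar x)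

/-- The empirical characteristic function `t ↦ (1/n) ∑ exp(i t x_k)`. -/
def ecf {n : ℕ} (x : Fin n → ℝ) : C(ℝ, ℂ) where
  toFun t := (1 / (n : ℂ)) * ∑ k, Complex.exp (Complex.I * t * x k)
  continuous_toFun := by fun_prop

/-- The standardized empirical characteristic function
`t ↦ exp(-i t x̄ / S) * ecf (t / S)`. For a nonempty sample with `S = 0` (all observations equal),
where the formula is not defined mathematically, division by zero gives the constant function `1`,
the empirical characteristic function of the centered data. -/
def stdEcf {n : ℕ} (x : Fin n → ℝ) : C(ℝ, ℂ) where
  toFun t := Complex.exp (-Complex.I * t * ((sampleMean x / sampleSD x : ℝ) : ℂ))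
    * ecf x (t / sampleSD x)
  continuous_toFun := by
    have h : Continuous fun t : ℝ => ecf x (t / sampleSD x) :=
      (ecf x).continuous.comp (continuous_id.div_const _)
    fun_prop

/-- The characteristic function `ψ₀(t) = exp(-t²/2)` of the standard normal distribution. -/
def psi0 (t : ℝ) : ℂ :=
  Complex.exp (-(t : ℂ) ^ 2 / 2)

/-- The self-similarity operator `𝒮_m[f](t) = f(t / √m) ^ m`. -/
def selfSimOp (m : ℕ) (f : C(ℝ, ℂ)) : C(ℝ, ℂ) where
  toFun t := f (t / √(m : ℝ)) ^ m
  continuous_toFun := by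
    have h : Continuous fun t : ℝ => f (t / √(m : ℝ)) :=
      f.continuous.comp (continuous_id.div_const _)
    fun_prop

/-- The empirical self-similarity transform `S_m^{(n)}`. -/
def selfSimTransform {n : ℕ} (m : ℕ) (x : Fin n → ℝ) : C(ℝ, ℂ) :=
  selfSimOp m (stdEcf x)

/-- The iterative discrepancy `D_m^{(n)} = S_{m+1}^{(n)} - S_m^{(n)}`. -/
def discrepancy {n : ℕ} (m : ℕ) (x : Fin n → ℝ) : C(ℝ, ℂ) :=
  selfSimTransform (m + 1) x - selfSimTransform m x

/-- The process `U_n(t) = √n (ψ̂*(t) - ψ₀(t))`. -/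
def deviation {n : ℕ} (x : Fin n → ℝ) (t : ℝ) : ℂ :=
  (√(n : ℝ) : ℂ) * (stdEcf x t - psi0 t)

/-- The transformed deviation
`H_m^{(n)}(t) = (m+1) U_n(t/√(m+1)) / ψ₀(t/√(m+1)) - m U_n(t/√m) / ψ₀(t/√m)`. -/
def transformedDeviation {n : ℕ} (m : ℕ) (x : Fin n → ℝ) (t : ℝ) : ℂ :=
  ((m : ℂ) + 1) * (deviation x (t / √((m : ℝ) + 1)) / psi0 (t / √((m : ℝ) + 1)))
    - (m : ℂ) * (deviation x (t / √(m : ℝ)) / psi0 (t / √(m : ℝ)))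

/-- `Y_n = o_P(a_n)` as `n → ∞`: `Y_n / a_n → 0` in probability. -/
def IsLittleOP {Ω : Type*} [MeasurableSpace Ω] (P : Measure Ω)
    (Y : ℕ → Ω → ℝ) (a : ℕ → ℝ) : Prop :=
  TendstoInMeasure P (fun n ω => Y n ω / a n) atTop (fun _ => 0)

/-- `Y_n = O_P(a_n)` as `n → ∞`: for every `ε > 0` there is a constant `C` such that
`P(|Y_n| > C |a_n|) ≤ ε` for all large `n`. -/
def IsBigOP {Ω : Type*} [MeasurableSpace Ω] (P : Measure Ω)
    (Y : ℕ → Ω → ℝ) (a : ℕ → ℝ) : Prop :=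
  ∀ ε : ℝ, 0 < ε → ∃ C : ℝ, 0 < C ∧
    ∀ᶠ n in atTop, P {ω | C * |a n| < |Y n ω|} ≤ ENNReal.ofReal ε

end

end SelfSimilarityTest

namespace SelfSimilarityTest

/-! Since `psi0 (t / √m) ^ m = psi0 t`, the Gaussian characteristic function is a fixed point of
every self-similarity operator. Expand `a ↦ a ^ m` to first order at `b = psi0 (t / √m)`. The
zeroth-order terms cancel in `D_m`, the linear terms `m b ^ (m - 1) (a - b)` are exactly `psi0 / √n`
times the two terms of `H_m` (`discrepancy_eq`), and what is left is quadratic in the deviation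
`stdEcf - psi0`, because `a` and `b` lie in the unit disc.

Everything thus rests on the supremum of `|stdEcf - psi0|` over `[-T, T]` being `O_P(n^(-1/2))`. The
remainder is then `O_P(1/n)`, and `D_m` inherits the rate because powers are Lipschitz on the unit
disc. Uniform integrability is free: the remainder has a deterministic bound.

For the uniform rate, affine invariance reduces to standard normal data. There `stdEcf - psi0` is
controlled by the errors of the sample mean, the second moment and the plain `ecf` on `[-2T, 2T]`
(`norm_stdEcf_sub_psi0_le`). The first two are variance bounds. For the third, both functions equal
`1` at `0`, so the supremum is at most the integral of the absolute derivative of the difference,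
whose expectation is `O(n^(-1/2))` by Tonelli and a variance bound at each point. -/

lemma stdEcf_apply {n : ℕ} (x : Fin n → ℝ) (t : ℝ) :
    stdEcf x t = (1 / (n : ℂ)) * ∑ k, Complex.exp
      (Complex.I * t * (((x k - sampleMean x) / sampleSD x : ℝ) : ℂ)) := by
  simp only [stdEcf, ecf, ContinuousMap.coe_mk]
  rw [mul_left_comm, Finset.mul_sum]
  congr 1
  refine Finset.sum_congr rfl fun k _ => ?_
  rw [← Complex.exp_add]
  congr 1
  push_cast
  ring

lemma norm_exp_I_mul_mul (t a : ℝ) : ‖Complex.exp (Complex.I * t * (a : ℂ))‖ = 1 := by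
  rw [show Complex.I * t * (a : ℂ) = ((t * a : ℝ) : ℂ) * Complex.I by push_cast; ring,
    Complex.norm_exp_ofReal_mul_I]

lemma norm_avg_exp_le_one {n : ℕ} (z : Fin n → ℝ) (t : ℝ) :
    ‖(1 / (n : ℂ)) * ∑ k, Complex.exp (Complex.I * t * (z k : ℂ))‖ ≤ 1 := by
  rw [norm_mul, norm_div, norm_one, Complex.norm_natCast]
  have h : ‖∑ k, Complex.exp (Complex.I * t * (z k : ℂ))‖ ≤ n := by
    refine (norm_sum_le _ _).trans ?_
    simp [norm_exp_I_mul_mul]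
  calc _ ≤ 1 / (n : ℝ) * n := by gcongr
    _ ≤ 1 := by rw [one_div]; exact inv_mul_le_one

lemma norm_stdEcf_le_one {n : ℕ} (x : Fin n → ℝ) (t : ℝ) : ‖stdEcf x t‖ ≤ 1 := by
  rw [stdEcf_apply]
  exact norm_avg_exp_le_one _ t

lemma norm_ecf_le_one {n : ℕ} (x : Fin n → ℝ) (t : ℝ) : ‖ecf x t‖ ≤ 1 :=
  norm_avg_exp_le_one x t

lemma psi0_eq_ofReal (t : ℝ) : psi0 t = (Real.exp (-t ^ 2 / 2) : ℂ) := by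
  simp [psi0]

lemma norm_psi0_le_one (t : ℝ) : ‖psi0 t‖ ≤ 1 := by
  rw [psi0_eq_ofReal, Complex.norm_real, Real.norm_of_nonneg (Real.exp_nonneg _),
    Real.exp_le_one_iff]
  nlinarith [sq_nonneg t]

lemma psi0_ne_zero (t : ℝ) : psi0 t ≠ 0 := Complex.exp_ne_zero _

lemma continuous_psi0 : Continuous psi0 := by
  unfold psi0; fun_prop

lemma psi0_div_sqrt_pow {m : ℕ} (hm : m ≠ 0) (t : ℝ) : psi0 (t / √(m : ℝ)) ^ m = psi0 t := by
  have hm' : (m : ℂ) ≠ 0 := by exact_mod_cast hm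
  have h : ((√(m : ℝ) : ℝ) : ℂ) ^ 2 = m := by
    rw [← Complex.ofReal_pow, Real.sq_sqrt (Nat.cast_nonneg m), Complex.ofReal_natCast]
  rw [psi0, psi0, ← Complex.exp_nat_mul]
  congr 1
  push_cast
  rw [div_pow, h]
  field_simp

/-! ### Expansion of powers and linearization of the discrepancy. -/

/-- Going from `m` to `m + 1` multiplies the old error by `a`, with `|a| ≤ 1`, and adds at most `m
|a - b|²`; the increments sum to less than `m²`. -/
lemma norm_pow_sub_pow_sub_linear_le {a b : ℂ} (ha : ‖a‖ ≤ 1) (hb : ‖b‖ ≤ 1) (m : ℕ) :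
    ‖a ^ m - b ^ m - m * b ^ (m - 1) * (a - b)‖ ≤ m ^ 2 * ‖a - b‖ ^ 2 := by
  induction m with
  | zero => simp
  | succ m ih =>
    -- At `m = 0` the truncated exponent `m - 1` is harmless because of the factor `m`.
    have hbm : b ^ m * m = b * (m * b ^ (m - 1)) := by
      cases m with
      | zero => simp
      | succ k => simp only [Nat.add_sub_cancel]; ring
    have e : a ^ (m + 1) - b ^ (m + 1) - ((m + 1 : ℕ) : ℂ) * b ^ (m + 1 - 1) * (a - b)
        = a * (a ^ m - b ^ m - m * b ^ (m - 1) * (a - b))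
          + m * b ^ (m - 1) * (a - b) ^ 2 := by
      simp only [Nat.add_sub_cancel]
      push_cast
      linear_combination (b - a) * hbm
    rw [e]
    refine (norm_add_le _ _).trans ?_
    have h1 : ‖a * (a ^ m - b ^ m - m * b ^ (m - 1) * (a - b))‖ ≤ m ^ 2 * ‖a - b‖ ^ 2 := by
      rw [norm_mul]
      exact (mul_le_of_le_one_left (norm_nonneg _) ha).trans ih
    have h2 : ‖(m : ℂ) * b ^ (m - 1) * (a - b) ^ 2‖ ≤ m * ‖a - b‖ ^ 2 := by
      rw [norm_mul, norm_mul, norm_pow, norm_pow, Complex.norm_natCast]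
      gcongr
      exact mul_le_of_le_one_right (Nat.cast_nonneg m) (pow_le_one₀ (norm_nonneg _) hb)
    push_cast
    nlinarith [sq_nonneg ‖a - b‖, Nat.cast_nonneg (α := ℝ) m]

lemma norm_pow_sub_pow_le {a b : ℂ} (ha : ‖a‖ ≤ 1) (hb : ‖b‖ ≤ 1) (m : ℕ) :
    ‖a ^ m - b ^ m‖ ≤ m * ‖a - b‖ := by
  induction m with
  | zero => simp
  | succ m ih =>
    rw [show a ^ (m + 1) - b ^ (m + 1) = a * (a ^ m - b ^ m) + b ^ m * (a - b) by ring]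
    refine (norm_add_le _ _).trans ?_
    rw [norm_mul, norm_mul, norm_pow]
    have h1 := (mul_le_of_le_one_left (norm_nonneg (a ^ m - b ^ m)) ha).trans ih
    have h2 := mul_le_of_le_one_left (norm_nonneg (a - b))
      (pow_le_one₀ (n := m) (norm_nonneg b) hb)
    push_cast
    linarith

/-- The scaling map `t ↦ t / √m`. -/
noncomputable def divSqrt (m : ℕ) : C(ℝ, ℝ) := ⟨fun t => t / √(m : ℝ), by fun_prop⟩

/-- The Gaussian characteristic function as a continuous map. -/
noncomputable def psi0Map : C(ℝ, ℂ) := ⟨psi0, continuous_psi0⟩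

/-- The second-order remainder of `f ↦ 𝒮_m[f]` at `ψ₀`. -/
noncomputable def linRemainder (m : ℕ) (f : C(ℝ, ℂ)) : C(ℝ, ℂ) :=
  f.comp (divSqrt m) ^ m - psi0Map.comp (divSqrt m) ^ m
    - (m : C(ℝ, ℂ)) * psi0Map.comp (divSqrt m) ^ (m - 1)
      * (f.comp (divSqrt m) - psi0Map.comp (divSqrt m))

lemma linRemainder_apply (m : ℕ) (f : C(ℝ, ℂ)) (t : ℝ) :
    linRemainder m f t = f (t / √(m : ℝ)) ^ m - psi0 (t / √(m : ℝ)) ^ m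
      - m * psi0 (t / √(m : ℝ)) ^ (m - 1) * (f (t / √(m : ℝ)) - psi0 (t / √(m : ℝ))) := rfl

/-- Continuity in the compact-open topology; it serves the measurability of the remainder as a
random element. -/
lemma continuous_linRemainder (m : ℕ) : Continuous (linRemainder m) := by
  have h : Continuous fun f : C(ℝ, ℂ) => f.comp (divSqrt m) :=
    ContinuousMap.continuous_precomp _
  unfold linRemainder
  fun_prop

/-- Rescaling never leaves the interval, so one uniform bound on `[-T, T]` serves every `m`; for `m
= 0` the quotient is `0` by convention. -/
lemma div_sqrt_mem_Icc {T t : ℝ} (ht : t ∈ Set.Icc (-T) T) (m : ℕ) :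
    t / √(m : ℝ) ∈ Set.Icc (-T) T := by
  rw [Set.mem_Icc, ← abs_le] at ht ⊢
  rcases Nat.eq_zero_or_pos m with rfl | hm
  · simpa using (abs_nonneg t).trans ht
  rw [abs_div, abs_of_nonneg (Real.sqrt_nonneg _)]
  refine (div_le_self (abs_nonneg t) ?_).trans ht
  rw [Real.one_le_sqrt]
  exact_mod_cast hm

/-- The remainder in the linearization of the discrepancy of a sample. -/
noncomputable def discrepancyRemainder {n : ℕ} (T : ℝ) (m : ℕ) (x : Fin n → ℝ) :
    C(Set.Icc (-T) T, ℂ) :=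
  (linRemainder (m + 1) (stdEcf x) - linRemainder m (stdEcf x)).restrict _

lemma discrepancy_eq {n : ℕ} (hn : n ≠ 0) {m : ℕ} (hm : m ≠ 0) {T : ℝ} (x : Fin n → ℝ)
    (t : Set.Icc (-T) T) :
    discrepancy m x t = psi0 t / (√(n : ℝ) : ℂ) * transformedDeviation m x t
      + discrepancyRemainder T m x t := by
  have hn' : ((√(n : ℝ) : ℝ) : ℂ) ≠ 0 := by
    rw [Complex.ofReal_ne_zero]
    positivity
  -- The factor `√n` cancels against the one in `deviation`, and one of the `j` factors in `psi0 t =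
  -- psi0 (t / √j) ^ j` cancels the denominator.
  have key : ∀ j : ℕ, j ≠ 0 → psi0 t / (√(n : ℝ) : ℂ)
      * ((j : ℂ) * (deviation x (t / √(j : ℝ)) / psi0 (t / √(j : ℝ))))
      = j * psi0 (t / √(j : ℝ)) ^ (j - 1) * (stdEcf x (t / √(j : ℝ)) - psi0 (t / √(j : ℝ))) := by
    intro j hj
    obtain ⟨k, rfl⟩ := Nat.exists_eq_succ_of_ne_zero hj
    have h0 := psi0_ne_zero (t / √((k.succ : ℕ) : ℝ))
    rw [← psi0_div_sqrt_pow hj t, deviation, Nat.succ_sub_one, Nat.succ_eq_add_one, pow_succ]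
    field_simp
  have h1 := key (m + 1) m.succ_ne_zero
  have h2 := key m hm
  have e : discrepancyRemainder T m x t
      = linRemainder (m + 1) (stdEcf x) t - linRemainder m (stdEcf x) t := rfl
  have e' : discrepancy m x t = stdEcf x (t / √((m + 1 : ℕ) : ℝ)) ^ (m + 1)
      - stdEcf x (t / √(m : ℝ)) ^ m := rfl
  rw [e, e', linRemainder_apply, linRemainder_apply, ← h1, ← h2, psi0_div_sqrt_pow hm,
    psi0_div_sqrt_pow m.succ_ne_zero, transformedDeviation]
  push_cast
  ring

lemma norm_linRemainder_le {n : ℕ} {T δ : ℝ} (m : ℕ) (x : Fin n → ℝ)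
    (h : ∀ t ∈ Set.Icc (-T) T, ‖stdEcf x t - psi0 t‖ ≤ δ) {t : ℝ} (ht : t ∈ Set.Icc (-T) T) :
    ‖linRemainder m (stdEcf x) t‖ ≤ m ^ 2 * δ ^ 2 := by
  rw [linRemainder_apply]
  refine (norm_pow_sub_pow_sub_linear_le (norm_stdEcf_le_one _ _) (norm_psi0_le_one _) m).trans ?_
  gcongr
  exact h _ (div_sqrt_mem_Icc ht m)

lemma norm_discrepancyRemainder_le {n : ℕ} {T δ : ℝ} (m : ℕ) (x : Fin n → ℝ)
    (h : ∀ t ∈ Set.Icc (-T) T, ‖stdEcf x t - psi0 t‖ ≤ δ) :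
    ‖discrepancyRemainder T m x‖ ≤ (((m : ℝ) + 1) ^ 2 + m ^ 2) * δ ^ 2 := by
  rw [ContinuousMap.norm_le _ (by positivity)]
  intro t
  refine (norm_sub_le _ _).trans ?_
  have h1 := norm_linRemainder_le (m + 1) x h t.2
  have h2 := norm_linRemainder_le m x h t.2
  push_cast at h1
  linarith

/-- The trivial deviation bound `δ = 2` always applies; this gives uniform integrability for every
`p`. -/
lemma norm_discrepancyRemainder_le_const {n : ℕ} (T : ℝ) (m : ℕ) (x : Fin n → ℝ) :
    ‖discrepancyRemainder T m x‖ ≤ (((m : ℝ) + 1) ^ 2 + m ^ 2) * 2 ^ 2 :=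
  norm_discrepancyRemainder_le m x fun t _ => (norm_sub_le _ _).trans (by
    linarith [norm_stdEcf_le_one x t, norm_psi0_le_one t])

/-- Both transforms are compared with their common fixed point `psi0`; the constant is `(m + 1) +
m`. -/
lemma norm_discrepancy_restrict_le {n : ℕ} {T δ : ℝ} (hδ : 0 ≤ δ) {m : ℕ} (hm : m ≠ 0)
    (x : Fin n → ℝ) (h : ∀ t ∈ Set.Icc (-T) T, ‖stdEcf x t - psi0 t‖ ≤ δ) :
    ‖(discrepancy m x).restrict (Set.Icc (-T) T)‖ ≤ (2 * m + 1) * δ := by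
  rw [ContinuousMap.norm_le _ (by positivity)]
  intro t
  have key : ∀ j : ℕ, j ≠ 0 → ‖stdEcf x (t / √(j : ℝ)) ^ j - psi0 t‖ ≤ j * δ := by
    intro j hj
    rw [← psi0_div_sqrt_pow hj t]
    refine (norm_pow_sub_pow_le (norm_stdEcf_le_one _ _) (norm_psi0_le_one _) j).trans ?_
    gcongr
    exact h _ (div_sqrt_mem_Icc t.2 j)
  have h1 := key (m + 1) m.succ_ne_zero
  have h2 := key m hm
  have e : (discrepancy m x).restrict (Set.Icc (-T) T) t
      = (stdEcf x (t / √((m + 1 : ℕ) : ℝ)) ^ (m + 1) - psi0 t)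
        - (stdEcf x (t / √(m : ℝ)) ^ m - psi0 t) :=
    (sub_sub_sub_cancel_right _ _ _).symm
  rw [e]
  refine (norm_sub_le _ _).trans ?_
  push_cast at h1 h2 ⊢
  linarith

/-! ### Measurability of the remainder. -/

lemma continuous_ecf {n : ℕ} : Continuous (ecf : (Fin n → ℝ) → C(ℝ, ℂ)) := by
  refine ContinuousMap.continuous_of_continuous_uncurry _ ?_
  simp only [Function.uncurry_def, ecf, ContinuousMap.coe_mk]
  fun_prop

lemma stdEcf_eq_ecf {n : ℕ} (x : Fin n → ℝ) :
    stdEcf x = ecf fun k => (x k - sampleMean x) / sampleSD x :=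
  ContinuousMap.ext fun t => stdEcf_apply x t

/-- Division by the sample deviation is only measurable, so it is confined to the standardized data
`z`; from `z` to the remainder in `C([-T, T])` the map is continuous. -/
lemma stronglyMeasurable_discrepancyRemainder {Ω : Type*} [MeasurableSpace Ω] {n : ℕ} (T : ℝ)
    (m : ℕ) {X : Fin n → Ω → ℝ} (hX : ∀ k, Measurable (X k)) :
    StronglyMeasurable fun ω => discrepancyRemainder T m fun k => X k ω := by
  have hmean : Measurable fun ω => sampleMean fun k => X k ω := by
    unfold sampleMean; fun_prop
  have hsd : Measurable fun ω => sampleSD fun k => X k ω := by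
    unfold sampleSD sampleVar; fun_prop
  have hz : Measurable fun ω => fun k : Fin n =>
      (X k ω - sampleMean fun k => X k ω) / sampleSD fun k => X k ω :=
    measurable_pi_lambda _ fun k => ((hX k).sub hmean).div hsd
  have hc : Continuous fun z : Fin n → ℝ =>
      (linRemainder (m + 1) (ecf z) - linRemainder m (ecf z)).restrict (Set.Icc (-T) T) :=
    (ContinuousMap.continuous_restrict _).comp
      (((continuous_linRemainder _).comp continuous_ecf).sub
        ((continuous_linRemainder _).comp continuous_ecf))
  simp only [discrepancyRemainder, stdEcf_eq_ecf]
  exact hc.comp_stronglyMeasurable hz.stronglyMeasurable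

/-! ### From the empirical to the standardized empirical characteristic function. -/

lemma stdEcf_standardize {n : ℕ} (hn : n ≠ 0) (x : Fin n → ℝ) (μ : ℝ) {σ : ℝ} (hσ : 0 < σ) :
    stdEcf (fun k => (x k - μ) / σ) = stdEcf x := by
  have hn' : (n : ℝ) ≠ 0 := by exact_mod_cast hn
  have hmean : sampleMean (fun k => (x k - μ) / σ) = (sampleMean x - μ) / σ := by
    simp only [sampleMean, ← Finset.sum_div, Finset.sum_sub_distrib, Finset.sum_const,
      Finset.card_univ, Fintype.card_fin, nsmul_eq_mul]
    field_simp
  have hvar : sampleVar (fun k => (x k - μ) / σ) = sampleVar x / σ ^ 2 := by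
    simp only [sampleVar, hmean, ← sub_div, sub_sub_sub_cancel_right, div_pow, ← Finset.sum_div]
    rw [div_right_comm]
  have hsd : sampleSD (fun k => (x k - μ) / σ) = sampleSD x / σ := by
    rw [sampleSD, hvar, Real.sqrt_div' _ (sq_nonneg σ), Real.sqrt_sq hσ.le, sampleSD]
  rw [stdEcf_eq_ecf, stdEcf_eq_ecf]
  congr 1
  funext k
  rw [hmean, hsd, ← sub_div, sub_sub_sub_cancel_right, div_div_div_cancel_right₀ hσ.ne']

lemma sampleVar_eq {n : ℕ} (hn : n ≠ 0) (x : Fin n → ℝ) :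
    sampleVar x = (∑ k, x k ^ 2) / n - sampleMean x ^ 2 := by
  have hn' : (n : ℝ) ≠ 0 := by exact_mod_cast hn
  have hs : ∑ k, x k = n * sampleMean x := by rw [sampleMean]; field_simp
  have h : ∑ k, (x k - sampleMean x) ^ 2 = ∑ k, x k ^ 2 - n * sampleMean x ^ 2 := by
    simp only [sub_sq, Finset.sum_add_distrib, Finset.sum_sub_distrib, ← Finset.sum_mul,
      ← Finset.mul_sum, hs, Finset.sum_const, Finset.card_univ, Fintype.card_fin, nsmul_eq_mul]
    ring
  rw [sampleVar, h]
  field_simp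

lemma abs_exp_neg_sub_exp_neg_le {a b : ℝ} (ha : 0 ≤ a) (hb : 0 ≤ b) :
    |Real.exp (-a) - Real.exp (-b)| ≤ |a - b| := by
  wlog h : a ≤ b generalizing a b
  · rw [abs_sub_comm, abs_sub_comm a]
    exact this hb ha (le_of_not_ge h)
  have h1 : Real.exp (-b) ≤ Real.exp (-a) := Real.exp_le_exp.2 (by linarith)
  rw [abs_of_nonneg (by linarith), abs_of_nonpos (by linarith)]
  have h2 : Real.exp (-b) = Real.exp (-a) * Real.exp (-(b - a)) := by
    rw [← Real.exp_add]; congr 1; ring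
  have h3 : 1 - (b - a) ≤ Real.exp (-(b - a)) := by linarith [Real.add_one_le_exp (-(b - a))]
  have h4 : Real.exp (-a) ≤ 1 := Real.exp_le_one_iff.2 (by linarith)
  have h5 := Real.exp_pos (-a)
  nlinarith

/-- Purely deterministic. The three terms of the constant come from the centering phase (`2T`), the
`ecf` error at `t / S` (`1`), and the change of `psi0` from `t / S` to `t` (`4T²`). -/
lemma norm_stdEcf_sub_psi0_le {n : ℕ} (hn : n ≠ 0) {T δ : ℝ} (hδ : δ ≤ 1 / 4)
    (x : Fin n → ℝ) (hmean : |sampleMean x| ≤ δ) (hsq : |(∑ k, x k ^ 2) / n - 1| ≤ δ)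
    (hecf : ∀ t ∈ Set.Icc (-(2 * T)) (2 * T), ‖ecf x t - psi0 t‖ ≤ δ)
    {t : ℝ} (ht : t ∈ Set.Icc (-T) T) :
    ‖stdEcf x t - psi0 t‖ ≤ (2 * T + 1 + 4 * T ^ 2) * δ := by
  have hδ0 : 0 ≤ δ := (abs_nonneg _).trans hmean
  have hm2 : sampleMean x ^ 2 ≤ δ := by
    rw [← sq_abs]; nlinarith [abs_nonneg (sampleMean x)]
  have hv : |sampleVar x - 1| ≤ 2 * δ := by
    rw [sampleVar_eq hn]
    rw [abs_le] at hsq ⊢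
    constructor <;> nlinarith [sq_nonneg (sampleMean x)]
  set S := sampleSD x with hS
  -- Here `δ ≤ 1 / 4` enters: it keeps `S ≥ 1 / 2`, so `t / S` stays in `[-2T, 2T]`.
  have hvar : (1 / 2 : ℝ) ≤ sampleVar x := by
    rw [abs_le] at hv; linarith
  have hS2 : S ^ 2 = sampleVar x := by
    rw [hS, sampleSD, Real.sq_sqrt (by linarith)]
  have hS0 : 0 ≤ S := Real.sqrt_nonneg _
  have hSh : 1 / 2 ≤ S := by nlinarith
  have hSpos : 0 < S := by linarith
  have htT : |t| ≤ T := abs_le.2 ht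
  have hT : 0 ≤ T := (abs_nonneg t).trans htT
  have hdiv : ∀ a : ℝ, |a / S| ≤ 2 * |a| := fun a => by
    rw [abs_div, abs_of_pos hSpos, div_le_iff₀ hSpos]
    nlinarith [abs_nonneg a]
  have ht2 : t / S ∈ Set.Icc (-(2 * T)) (2 * T) := by
    rw [Set.mem_Icc, ← abs_le]
    linarith [hdiv t]
  have e : stdEcf x t - psi0 t
      = (Complex.exp (Complex.I * ((-(t * (sampleMean x / S)) : ℝ) : ℂ)) - 1) * ecf x (t / S)
        + (ecf x (t / S) - psi0 (t / S)) + (psi0 (t / S) - psi0 t) := by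
    have : stdEcf x t
        = Complex.exp (Complex.I * ((-(t * (sampleMean x / S)) : ℝ) : ℂ)) * ecf x (t / S) := by
      simp only [stdEcf, ContinuousMap.coe_mk, ← hS]
      congr 2
      push_cast
      ring
    rw [this]
    ring
  have h1 : ‖(Complex.exp (Complex.I * ((-(t * (sampleMean x / S)) : ℝ) : ℂ)) - 1)
      * ecf x (t / S)‖ ≤ 2 * T * δ := by
    rw [norm_mul]
    refine (mul_le_of_le_one_right (norm_nonneg _) (norm_ecf_le_one _ _)).trans ?_
    refine (Real.norm_exp_I_mul_ofReal_sub_one_le).trans ?_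
    rw [norm_neg, norm_mul, Real.norm_eq_abs, Real.norm_eq_abs]
    calc |t| * |sampleMean x / S| ≤ T * (2 * δ) := by
          gcongr
          linarith [hdiv (sampleMean x)]
      _ = 2 * T * δ := by ring
  have h3 : ‖psi0 (t / S) - psi0 t‖ ≤ 4 * T ^ 2 * δ := by
    rw [psi0_eq_ofReal, psi0_eq_ofReal, ← Complex.ofReal_sub, Complex.norm_real,
      Real.norm_eq_abs, neg_div, neg_div]
    refine (abs_exp_neg_sub_exp_neg_le (by positivity) (by positivity)).trans ?_
    have : (t / S) ^ 2 / 2 - t ^ 2 / 2 = -(t ^ 2 * (sampleVar x - 1)) / (2 * S ^ 2) := by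
      rw [← hS2]
      field_simp
      ring
    rw [this, abs_div, abs_neg, abs_mul, abs_of_pos (show 0 < 2 * S ^ 2 by positivity),
      div_le_iff₀ (by positivity), hS2, abs_of_nonneg (sq_nonneg t)]
    have htsq : t ^ 2 ≤ T ^ 2 := sq_le_sq' ht.1 ht.2
    calc t ^ 2 * |sampleVar x - 1| ≤ T ^ 2 * (2 * δ) := by gcongr
      _ ≤ 4 * T ^ 2 * δ * (2 * sampleVar x) := by
        nlinarith [mul_nonneg (sq_nonneg T) hδ0]
  rw [e]
  have h2 := hecf _ ht2
  calc _ ≤ 2 * T * δ + δ + 4 * T ^ 2 * δ := norm_add_le_of_le (norm_add_le_of_le h1 h2) h3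
    _ = _ := by ring

/-! ### Mean absolute error of empirical averages. -/

section EmpiricalMeans

variable {Ω : Type*} [MeasurableSpace Ω] {P : Measure Ω}
  {ν : Measure ℝ} {Y : ℕ → Ω → ℝ}

lemma lintegral_enorm_avg_sub_integral_le [IsProbabilityMeasure P] (hY : ∀ k, Measurable (Y k)) (hindep : iIndepFun Y P)
    (hlaw : ∀ k, HasLaw (Y k) ν P) {g : ℝ → ℝ} (hg : Measurable g) (hg2 : MemLp g 2 ν) {V : ℝ}
    (hV : ∫ y, g y ^ 2 ∂ν ≤ V) {n : ℕ} (hn : n ≠ 0) :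
    ∫⁻ ω, ‖(∑ k : Fin n, g (Y k ω)) / n - ∫ y, g y ∂ν‖ₑ ∂P
      ≤ ENNReal.ofReal ((V + 1) / √(n : ℝ)) := by
  have hn0 : (n : ℝ) ≠ 0 := by exact_mod_cast hn
  have hnpos : (0 : ℝ) < n := by positivity
  have hmp : ∀ k, MeasurePreserving (Y k) P ν := fun k => (hlaw k).measurePreserving (hY k)
  have hLp : ∀ k : Fin n, MemLp (fun ω => g (Y k ω)) 2 P := fun k =>
    hg2.comp_measurePreserving (hmp k)
  have hint : ∀ k, ∫ ω, g (Y k ω) ∂P = ∫ y, g y ∂ν := fun k =>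
    (hlaw k).integral_comp hg.aestronglyMeasurable
  have hvar : ∀ k, Var[fun ω => g (Y k ω); P] ≤ V := fun k => by
    refine (variance_le_expectation_sq (hg.comp (hY k)).aestronglyMeasurable).trans ?_
    have : ∫ ω, g (Y k ω) ^ 2 ∂P = ∫ y, g y ^ 2 ∂ν :=
      (hlaw k).integral_comp (f := fun y => g y ^ 2) (hg.pow_const 2).aestronglyMeasurable
    exact this.le.trans hV
  set A : Ω → ℝ := fun ω => (∑ k : Fin n, g (Y k ω)) / n with hA
  have hALp : MemLp A 2 P := by
    have := (memLp_finsetSum Finset.univ fun k _ => hLp k).const_mul ((n : ℝ)⁻¹)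
    refine this.ae_eq (Eventually.of_forall fun ω => ?_)
    simp only [hA]
    ring
  have hAint : ∫ ω, A ω ∂P = ∫ y, g y ∂ν := by
    simp only [hA]
    rw [integral_div, integral_finsetSum _ fun k _ => (hLp k).integrable (by norm_num)]
    simp only [hint, Finset.sum_const, Finset.card_univ, Fintype.card_fin, nsmul_eq_mul]
    field_simp
  have hAvar : Var[A; P] ≤ V / n := by
    have h1 : A = fun ω => (n : ℝ)⁻¹ * (∑ k : Fin n, fun ω => g (Y k ω)) ω := by
      funext ω
      simp only [hA, Finset.sum_apply]
      ring
    have h2 : Set.Pairwise (↑(Finset.univ : Finset (Fin n)))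
        fun i j : Fin n => (fun ω => g (Y i ω)) ⟂ᵢ[P] fun ω => g (Y j ω) := fun i _ j _ hij =>
      (hindep.indepFun (fun h => hij (Fin.ext h))).comp hg hg
    rw [h1, variance_const_mul, IndepFun.variance_sum (fun k _ => hLp k) h2]
    calc _ ≤ (n : ℝ)⁻¹ ^ 2 * ∑ _k : Fin n, V := by
          gcongr with k
          exact hvar k
      _ = V / n := by
          simp only [Finset.sum_const, Finset.card_univ, Fintype.card_fin, nsmul_eq_mul]
          field_simp
  set Z : Ω → ℝ := fun ω => A ω - ∫ y, g y ∂ν with hZ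
  have hZLp : MemLp Z 2 P := hALp.sub (memLp_const _)
  have hZ2 : ∫ ω, Z ω ^ 2 ∂P ≤ V / n := by
    rw [variance_eq_integral hALp.aestronglyMeasurable.aemeasurable, hAint] at hAvar
    exact hAvar
  have hV0 : 0 ≤ V := (integral_nonneg fun y => sq_nonneg (g y)).trans hV
  rw [← ofReal_integral_norm_eq_lintegral_enorm (hZLp.integrable (by norm_num))]
  refine ENNReal.ofReal_le_ofReal ?_
  have hs : 0 < √(n : ℝ) := Real.sqrt_pos.2 hnpos
  -- The pointwise inequality `|z| ≤ √n z² + 1 / √n` replaces Cauchy–Schwarz, hence the constant `V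
  -- + 1` instead of `√V`.
  calc ∫ ω, ‖Z ω‖ ∂P ≤ ∫ ω, (√(n : ℝ) * Z ω ^ 2 + 1 / √(n : ℝ)) ∂P := by
        refine integral_mono (hZLp.integrable (by norm_num)).norm
          ((hZLp.integrable_sq.const_mul _).add (integrable_const _)) fun ω => ?_
        have : ‖Z ω‖ * √(n : ℝ) ≤ (√(n : ℝ) * Z ω ^ 2 + 1 / √(n : ℝ)) * √(n : ℝ) := by
          rw [add_mul, one_div_mul_cancel hs.ne', Real.norm_eq_abs, ← sq_abs (Z ω)]
          nlinarith [sq_nonneg (|Z ω| * √(n : ℝ) - 1)]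
        exact le_of_mul_le_mul_right this hs
    _ = √(n : ℝ) * ∫ ω, Z ω ^ 2 ∂P + 1 / √(n : ℝ) := by
        rw [integral_add (hZLp.integrable_sq.const_mul _) (integrable_const _),
          integral_const_mul]
        simp
    _ ≤ √(n : ℝ) * (V / n) + 1 / √(n : ℝ) := by gcongr
    _ = (V + 1) / √(n : ℝ) := by
        have : √(n : ℝ) * (V / n) = V / √(n : ℝ) := by
          rw [eq_div_iff hs.ne', mul_right_comm, Real.mul_self_sqrt hnpos.le]
          field_simp
        rw [this]
        ring

lemma lintegral_enorm_avg_sub_integral_le_complex [IsProbabilityMeasure P]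
    [IsProbabilityMeasure ν] (hY : ∀ k, Measurable (Y k))
    (hindep : iIndepFun Y P) (hlaw : ∀ k, HasLaw (Y k) ν P) {g : ℝ → ℂ} (hg : Measurable g)
    (hg2 : MemLp g 2 ν) {V : ℝ} (hV : ∫ y, ‖g y‖ ^ 2 ∂ν ≤ V) {n : ℕ} (hn : n ≠ 0) :
    ∫⁻ ω, ‖(1 / (n : ℂ)) * ∑ k : Fin n, g (Y k ω) - ∫ y, g y ∂ν‖ₑ ∂P
      ≤ ENNReal.ofReal (2 * (V + 1) / √(n : ℝ)) := by
  have hgi : Integrable g ν := hg2.integrable (by norm_num)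
  have hsq : Integrable (fun y => ‖g y‖ ^ 2) ν := hg2.integrable_norm_pow (p := 2) (by norm_num)
  have hV0 : 0 ≤ V := (integral_nonneg fun y => sq_nonneg ‖g y‖).trans hV
  have hre : MemLp (fun y => (g y).re) 2 ν := hg2.re
  have him : MemLp (fun y => (g y).im) 2 ν := hg2.im
  have h1 := lintegral_enorm_avg_sub_integral_le hY hindep hlaw
    (Complex.measurable_re.comp hg) hre
    ((integral_mono hre.integrable_sq hsq fun y => by
      simpa using pow_le_pow_left₀ (abs_nonneg _) (Complex.abs_re_le_norm (g y)) 2).trans hV) hn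
  have h2 := lintegral_enorm_avg_sub_integral_le hY hindep hlaw
    (Complex.measurable_im.comp hg) him
    ((integral_mono him.integrable_sq hsq fun y => by
      simpa using pow_le_pow_left₀ (abs_nonneg _) (Complex.abs_im_le_norm (g y)) 2).trans hV) hn
  have hIre : (∫ y, g y ∂ν).re = ∫ y, (g y).re ∂ν := (integral_re hgi).symm
  have hIim : (∫ y, g y ∂ν).im = ∫ y, (g y).im ∂ν := (integral_im hgi).symm
  have hbound : ∀ ω, ‖(1 / (n : ℂ)) * ∑ k : Fin n, g (Y k ω) - ∫ y, g y ∂ν‖ₑ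
      ≤ ‖(∑ k : Fin n, (g (Y k ω)).re) / n - ∫ y, (g y).re ∂ν‖ₑ
        + ‖(∑ k : Fin n, (g (Y k ω)).im) / n - ∫ y, (g y).im ∂ν‖ₑ := by
    intro ω
    have hc : (1 / (n : ℂ)) = ((1 / (n : ℝ) : ℝ) : ℂ) := by push_cast; rfl
    have er : ((1 / (n : ℂ)) * ∑ k : Fin n, g (Y k ω) - ∫ y, g y ∂ν).re
        = (∑ k : Fin n, (g (Y k ω)).re) / n - ∫ y, (g y).re ∂ν := by
      rw [Complex.sub_re, hIre, hc, Complex.re_ofReal_mul, Complex.re_sum]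
      ring
    have ei : ((1 / (n : ℂ)) * ∑ k : Fin n, g (Y k ω) - ∫ y, g y ∂ν).im
        = (∑ k : Fin n, (g (Y k ω)).im) / n - ∫ y, (g y).im ∂ν := by
      rw [Complex.sub_im, hIim, hc, Complex.im_ofReal_mul, Complex.im_sum]
      ring
    rw [← er, ← ei, ← ofReal_norm, ← ofReal_norm, ← ofReal_norm,
      ← ENNReal.ofReal_add (norm_nonneg _) (norm_nonneg _)]
    exact ENNReal.ofReal_le_ofReal (Complex.norm_le_abs_re_add_abs_im _)
  calc _ ≤ ∫⁻ ω, (‖(∑ k : Fin n, (g (Y k ω)).re) / n - ∫ y, (g y).re ∂ν‖ₑ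
        + ‖(∑ k : Fin n, (g (Y k ω)).im) / n - ∫ y, (g y).im ∂ν‖ₑ) ∂P :=
        lintegral_mono hbound
    _ = _ := lintegral_add_left (by fun_prop) _
    _ ≤ _ := add_le_add h1 h2
    _ = ENNReal.ofReal (2 * (V + 1) / √(n : ℝ)) := by
        rw [← ENNReal.ofReal_add (by positivity) (by positivity)]
        congr 1
        ring

/-- Markov's inequality; `√n` cancels, so the bound does not depend on `n`. -/
lemma measure_le_of_lintegral_enorm_le {n : ℕ} (hn : n ≠ 0) {W : Ω → ENNReal}
    (hW : AEMeasurable W P) {K C : ℝ} (hC : 0 < C)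
    (h : ∫⁻ ω, W ω ∂P ≤ ENNReal.ofReal (K / √(n : ℝ))) :
    P {ω | ENNReal.ofReal (C / √(n : ℝ)) ≤ W ω} ≤ ENNReal.ofReal (K / C) := by
  have hs : 0 < √(n : ℝ) := Real.sqrt_pos.2 (by positivity)
  have hpos : 0 < C / √(n : ℝ) := by positivity
  refine (meas_ge_le_lintegral_div hW (ENNReal.ofReal_pos.2 hpos).ne'
    ENNReal.ofReal_ne_top).trans ?_
  refine (ENNReal.div_le_div_right h _).trans ?_
  rw [← ENNReal.ofReal_div_of_pos hpos, div_div_div_cancel_right₀ hs.ne']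

end EmpiricalMeans

/-! ### Uniform rate for standard normal data. -/

section Gaussian

/-- The standard normal distribution. -/
local notation "γ" => gaussianReal 0 1

lemma memLp_id_mul_exp (u : ℝ) :
    MemLp (fun y : ℝ => Complex.I * y * Complex.exp (Complex.I * u * (y : ℂ))) 2 γ := by
  refine (memLp_id_gaussianReal 2).of_le (by fun_prop) (Eventually.of_forall fun y => ?_)
  rw [norm_mul, norm_exp_I_mul_mul]
  simp

lemma integral_sq_gaussianReal_zero_one : ∫ y : ℝ, y ^ 2 ∂γ = 1 := by
  have h := variance_fun_id_gaussianReal (μ := 0) (v := 1)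
  rw [variance_eq_integral measurable_id'.aemeasurable] at h
  simpa using h

lemma integral_exp_gaussianReal (s : ℝ) :
    ∫ y : ℝ, Complex.exp (Complex.I * s * (y : ℂ)) ∂γ = psi0 s := by
  have h := charFun_gaussianReal (μ := 0) (v := 1) s
  rw [charFun_apply_real] at h
  rw [psi0, show (-(s : ℂ) ^ 2 / 2) = s * ((0 : ℝ) : ℂ) * Complex.I - ((1 : NNReal) : ℝ) * s ^ 2 / 2
    by push_cast; ring]
  rw [← h]
  congr 1
  funext y
  congr 1
  ring

lemma hasDerivAt_exp_I_mul_mul (y s : ℝ) :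
    HasDerivAt (fun s : ℝ => Complex.exp (Complex.I * s * (y : ℂ)))
      (Complex.I * y * Complex.exp (Complex.I * s * (y : ℂ))) s := by
  have h : HasDerivAt (fun s : ℝ => Complex.I * s * (y : ℂ)) (Complex.I * y) s := by
    simpa using ((Complex.ofRealCLM.hasDerivAt (x := s)).const_mul Complex.I).mul_const (y : ℂ)
  simpa [mul_comm] using h.cexp

lemma hasDerivAt_psi0 (s : ℝ) : HasDerivAt psi0 (-s * psi0 s) s := by
  have h : HasDerivAt (fun z : ℂ => -z ^ 2 / 2) (-(s : ℂ)) s := by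
    convert! ((hasDerivAt_pow 2 (s : ℂ)).neg).div_const 2 using 1
    simp only [Nat.cast_ofNat, Nat.add_one_sub_one, pow_one]
    ring
  have h2 : HasDerivAt psi0 (Complex.exp (-(s : ℂ) ^ 2 / 2) * -s) s := h.cexp.comp_ofReal
  rwa [mul_comm] at h2

/-- Differentiation of the characteristic function under the integral, dominated by `|y|`. It makes
`ecfDevDeriv` a centered empirical average. -/
lemma integral_id_mul_exp_gaussianReal (s : ℝ) :
    ∫ y : ℝ, Complex.I * y * Complex.exp (Complex.I * s * (y : ℂ)) ∂γ = -s * psi0 s := by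
  have h := hasDerivAt_integral_of_dominated_loc_of_deriv_le (μ := γ) (x₀ := s)
    (s := Set.univ) (F := fun (s : ℝ) (y : ℝ) => Complex.exp (Complex.I * s * (y : ℂ)))
    (F' := fun (s : ℝ) (y : ℝ) => Complex.I * y * Complex.exp (Complex.I * s * (y : ℂ)))
    (bound := fun y => |y|) univ_mem
    (Eventually.of_forall fun t => by fun_prop)
    (Integrable.of_bound (C := 1) (by fun_prop)
      (Eventually.of_forall fun y => (norm_exp_I_mul_mul s y).le))
    (by fun_prop)
    (Eventually.of_forall fun y t _ => by
      rw [norm_mul, norm_exp_I_mul_mul]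
      simp)
    (((memLp_id_gaussianReal 1).integrable (by norm_num)).abs)
    (Eventually.of_forall fun y t _ => hasDerivAt_exp_I_mul_mul y t)
  have h2 := h.2
  simp only [integral_exp_gaussianReal] at h2
  exact h2.unique (hasDerivAt_psi0 s)

/-- The derivative of `ecf x - ψ₀`. -/
noncomputable def ecfDevDeriv {n : ℕ} (x : Fin n → ℝ) (u : ℝ) : ℂ :=
  (1 / (n : ℂ)) * ∑ k, Complex.I * x k * Complex.exp (Complex.I * u * (x k : ℂ))
    - (-u * psi0 u)

lemma hasDerivAt_ecf_sub_psi0 {n : ℕ} (x : Fin n → ℝ) (s : ℝ) :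
    HasDerivAt (fun s => ecf x s - psi0 s) (ecfDevDeriv x s) s :=
  ((HasDerivAt.fun_sum fun k _ => hasDerivAt_exp_I_mul_mul (x k) s).const_mul _).sub
    (hasDerivAt_psi0 s)

lemma continuous_ecfDevDeriv {n : ℕ} :
    Continuous fun p : (Fin n → ℝ) × ℝ => ecfDevDeriv p.1 p.2 := by
  have := continuous_psi0
  unfold ecfDevDeriv
  fun_prop

/-- Fundamental theorem of calculus from `0`, where the difference vanishes. The right side does not
depend on `s`, which turns a supremum into an integral. -/
lemma enorm_ecf_sub_psi0_le {n : ℕ} (hn : n ≠ 0) (x : Fin n → ℝ) {A s : ℝ}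
    (hs : s ∈ Set.Icc (-A) A) :
    ‖ecf x s - psi0 s‖ₑ ≤ ∫⁻ u in Set.Icc (-A) A, ‖ecfDevDeriv x u‖ₑ := by
  have hn' : (n : ℂ) ≠ 0 := by exact_mod_cast hn
  have hcont : Continuous fun u => ecfDevDeriv x u := by
    have := continuous_psi0
    unfold ecfDevDeriv
    fun_prop
  have h0 : ecf x 0 - psi0 0 = 0 := by
    simp [ecf, psi0, hn']
  have hftc := intervalIntegral.integral_eq_sub_of_hasDerivAt
    (fun u _ => hasDerivAt_ecf_sub_psi0 x u) (hcont.intervalIntegrable 0 s)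
  rw [h0, sub_zero] at hftc
  have hA : 0 ≤ A := by linarith [hs.1, hs.2]
  rw [← hftc, ← ofReal_norm, intervalIntegral.norm_integral_eq_norm_integral_uIoc, ofReal_norm]
  refine (enorm_integral_le_lintegral_enorm _).trans (lintegral_mono_set ?_)
  exact Set.uIoc_subset_uIcc.trans (Set.uIcc_subset_Icc ⟨by linarith, hA⟩ hs)

variable {Ω : Type*} [MeasurableSpace Ω] {P : Measure Ω} [IsProbabilityMeasure P] {Y : ℕ → Ω → ℝ}

lemma lintegral_ecfDevDeriv_le (hY : ∀ k, Measurable (Y k)) (hindep : iIndepFun Y P)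
    (hlaw : ∀ k, HasLaw (Y k) γ P) {A : ℝ} {n : ℕ} (hn : n ≠ 0) :
    ∫⁻ ω, (∫⁻ u in Set.Icc (-A) A, ‖ecfDevDeriv (fun k : Fin n => Y k ω) u‖ₑ) ∂P
      ≤ ENNReal.ofReal (8 * A / √(n : ℝ)) := by
  have hmeas : Measurable fun p : Ω × ℝ => ecfDevDeriv (fun k : Fin n => Y k p.1) p.2 :=
    continuous_ecfDevDeriv.measurable.comp (f := fun p : Ω × ℝ => ((fun k : Fin n => Y k p.1), p.2))
      (by fun_prop)
  rw [lintegral_lintegral_swap hmeas.enorm.aemeasurable]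
  have hb : ∀ u : ℝ, ∫⁻ ω, ‖ecfDevDeriv (fun k : Fin n => Y k ω) u‖ₑ ∂P
      ≤ ENNReal.ofReal (4 / √(n : ℝ)) := by
    intro u
    have := lintegral_enorm_avg_sub_integral_le_complex hY hindep hlaw
      (g := fun y : ℝ => Complex.I * y * Complex.exp (Complex.I * u * (y : ℂ))) (by fun_prop)
      (memLp_id_mul_exp u) (V := 1) (by
        simp only [norm_mul _ (Complex.exp _), norm_exp_I_mul_mul]
        simp [integral_sq_gaussianReal_zero_one]) hn
    rw [integral_id_mul_exp_gaussianReal] at this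
    refine this.trans (ENNReal.ofReal_le_ofReal (le_of_eq ?_))
    norm_num
  refine (lintegral_mono hb).trans ?_
  -- The interval has length `2A` and each point contributes `4 / √n`, which gives `8A / √n`.
  rw [lintegral_const, Measure.restrict_apply_univ, Real.volume_Icc,
    ← ENNReal.ofReal_mul (by positivity)]
  refine ENNReal.ofReal_le_ofReal (le_of_eq ?_)
  ring

lemma exists_measure_stdEcf_sub_psi0_le (hY : ∀ k, Measurable (Y k)) (hindep : iIndepFun Y P)
    (hlaw : ∀ k, HasLaw (Y k) γ P) {T : ℝ} (hT : 0 < T) {ε : ℝ} (hε : 0 < ε) :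
    ∃ C : ℝ, 0 < C ∧ ∀ᶠ n : ℕ in atTop,
      P {ω | ¬ ∀ t ∈ Set.Icc (-T) T,
        ‖stdEcf (fun k : Fin n => Y k ω) t - psi0 t‖ ≤ C / √(n : ℝ)} ≤ ENNReal.ofReal ε := by
  have h4 : MemLp (fun y : ℝ => y ^ 2) 2 γ := by
    rw [memLp_two_iff_integrable_sq (by fun_prop)]
    refine ((memLp_id_gaussianReal (μ := 0) (v := 1) 4).integrable_norm_pow (p := 4)
      (by norm_num)).congr (Eventually.of_forall fun y => ?_)
    simp only [id, Real.norm_eq_abs]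
    rw [← pow_mul, show 2 * 2 = 4 from rfl, Even.pow_abs (by decide)]
  set V : ℝ := ∫ y : ℝ, (y ^ 2) ^ 2 ∂γ with hV
  have hV0 : 0 ≤ V := integral_nonneg fun y => sq_nonneg _
  -- The sum of the three mean-error constants (mean, second moment, `ecf` on `[-2T, 2T]`); with `c
  -- = 3K / ε` each exceptional event costs at most `ε / 3`.
  set K : ℝ := 2 + (V + 1) + 8 * (2 * T) with hK
  have hKpos : 0 < K := by positivity
  set c : ℝ := 3 * K / ε with hc
  have hcpos : 0 < c := by positivity
  refine ⟨(2 * T + 1 + 4 * T ^ 2) * c, by positivity, ?_⟩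
  have hlim : Tendsto (fun n : ℕ => c / √(n : ℝ)) atTop (𝓝 0) :=
    (Real.tendsto_sqrt_atTop.comp tendsto_natCast_atTop_atTop).const_div_atTop c
  filter_upwards [hlim.eventually (eventually_le_nhds (show (0 : ℝ) < 1 / 4 by norm_num)),
    eventually_ne_atTop 0] with n hsmall hn
  have hs : 0 < √(n : ℝ) := Real.sqrt_pos.2 (by positivity)
  have hKc : ∀ K', K' ≤ K → ENNReal.ofReal (K' / c) ≤ ENNReal.ofReal (ε / 3) := fun K' hK' => by
    refine ENNReal.ofReal_le_ofReal ?_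
    rw [hc, div_le_iff₀ (by positivity)]
    field_simp
    linarith
  have hB1 := (measure_le_of_lintegral_enorm_le hn (by fun_prop) hcpos
    (lintegral_enorm_avg_sub_integral_le hY hindep hlaw measurable_id
      (memLp_id_gaussianReal 2) (V := 1)
      (by simp [integral_sq_gaussianReal_zero_one]) hn)).trans (hKc _ (by simp only [hK]; nlinarith))
  have hB2 := (measure_le_of_lintegral_enorm_le hn (by fun_prop) hcpos
    (lintegral_enorm_avg_sub_integral_le hY hindep hlaw (measurable_id.pow_const 2)
      h4 hV.ge hn)).trans (hKc _ (by simp only [hK]; nlinarith))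
  have hmeas : Measurable fun p : Ω × ℝ => ecfDevDeriv (fun k : Fin n => Y k p.1) p.2 :=
    continuous_ecfDevDeriv.measurable.comp (f := fun p : Ω × ℝ => ((fun k : Fin n => Y k p.1), p.2))
      (by fun_prop)
  have hB3 := (measure_le_of_lintegral_enorm_le hn
    (hmeas.enorm.lintegral_prod_right').aemeasurable hcpos
    (lintegral_ecfDevDeriv_le hY hindep hlaw (A := 2 * T) hn)).trans
    (hKc _ (by simp only [hK]; nlinarith))
  have hlt : ∀ z : ℝ, ¬ ENNReal.ofReal (c / √(n : ℝ)) ≤ ‖z‖ₑ → |z| ≤ c / √(n : ℝ) := fun z hz => by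
    rw [← ofReal_norm, Real.norm_eq_abs] at hz
    exact (not_le.1 fun h => hz (ENNReal.ofReal_le_ofReal h)).le
  -- Outside the three exceptional events the deterministic estimate applies with `δ = c / √n`.
  refine (measure_mono (fun ω hω => ?_)).trans ((measure_union_le _ _).trans
    ((add_le_add ((measure_union_le _ _).trans (add_le_add hB1 hB2)) hB3).trans ?_))
  · by_contra hnot
    refine hω fun t ht => ?_
    simp only [Set.mem_union, not_or, Set.mem_ofPred_eq] at hnot
    obtain ⟨⟨hn1, hn2⟩, hn3⟩ := hnot
    have h1 := hlt _ hn1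
    have h2 := hlt _ hn2
    simp only [id, integral_id_gaussianReal, sub_zero, integral_sq_gaussianReal_zero_one] at h1 h2
    refine (norm_stdEcf_sub_psi0_le hn hsmall _ h1 h2 (fun s hs => ?_) ht).trans
      (mul_div_assoc _ _ _).ge
    have h3 := ((enorm_ecf_sub_psi0_le hn (fun k : Fin n => Y k ω) hs).trans_lt (not_le.1 hn3)).le
    rw [← ofReal_norm] at h3
    exact (ENNReal.ofReal_le_ofReal_iff (by positivity)).1 h3
  · rw [← ENNReal.ofReal_add (by positivity) (by positivity),
      ← ENNReal.ofReal_add (by positivity) (by positivity)]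
    exact ENNReal.ofReal_le_ofReal (by linarith)

end Gaussian

/-! ### Uniform integrability and passage to general normal data. -/

lemma uniformIntegrable_of_norm_le {ι Ω E : Type*} [MeasurableSpace Ω] [NormedAddCommGroup E]
    {P : Measure Ω} [IsFiniteMeasure P] {f : ι → Ω → E} (hf : ∀ i, AEStronglyMeasurable (f i) P)
    {B : ℝ} (hB : ∀ i ω, ‖f i ω‖ ≤ B) : UniformIntegrable f 1 P := by
  -- Truncating strictly above the common bound leaves an empty tail set.
  refine uniformIntegrable_of le_rfl ENNReal.one_ne_top hf fun ε _ => ⟨B.toNNReal + 1, fun i => ?_⟩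
  have h : {ω | B.toNNReal + 1 ≤ ‖f i ω‖₊} = ∅ := by
    ext ω
    simp only [Set.mem_ofPred_eq, Set.mem_empty_iff_false, iff_false, not_le]
    have : ‖f i ω‖₊ ≤ B.toNNReal := by
      rw [← NNReal.coe_le_coe, coe_nnnorm]
      exact (hB i ω).trans (Real.le_coe_toNNReal B)
    exact this.trans_lt (lt_add_one _)
  rw [h]
  simp

lemma exists_measure_stdEcf_sub_psi0_le_of_gaussianReal {Ω : Type*} [MeasurableSpace Ω]
    {P : Measure Ω} [IsProbabilityMeasure P] {μ σ : ℝ} (hσ : 0 < σ) {X : ℕ → Ω → ℝ}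
    (hX : ∀ k, Measurable (X k)) (hindep : iIndepFun X P)
    (hlaw : ∀ k, HasLaw (X k) (gaussianReal μ ⟨σ ^ 2, sq_nonneg σ⟩) P)
    {T : ℝ} (hT : 0 < T) {ε : ℝ} (hε : 0 < ε) :
    ∃ C : ℝ, 0 < C ∧ ∀ᶠ n : ℕ in atTop,
      P {ω | ¬ ∀ t ∈ Set.Icc (-T) T,
        ‖stdEcf (fun k : Fin n => X k ω) t - psi0 t‖ ≤ C / √(n : ℝ)} ≤ ENNReal.ofReal ε := by
  have hlawY : ∀ k, HasLaw (fun ω => (X k ω - μ) / σ) (gaussianReal 0 1) P := fun k => by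
    have hX' : HasLaw (X k) (gaussianReal μ (NNReal.mk (σ ^ 2) (sq_nonneg σ))) P := hlaw k
    have h := gaussianReal_div_const (gaussianReal_sub_const hX' μ) σ
    have h0 : NNReal.mk (σ ^ 2) (sq_nonneg σ) ≠ 0 := fun h0 =>
      (pow_pos hσ 2).ne' (congrArg NNReal.toReal h0)
    rwa [sub_self, zero_div, div_self h0] at h
  obtain ⟨C, hC, h⟩ := exists_measure_stdEcf_sub_psi0_le
    (Y := fun k ω => (X k ω - μ) / σ) (fun k => ((hX k).sub_const μ).div_const σ)
    (hindep.comp (fun _ x => (x - μ) / σ) fun _ => by fun_prop) hlawY hT hε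
  refine ⟨C, hC, ?_⟩
  filter_upwards [h, eventually_ne_atTop 0] with n hn hn0
  simpa only [stdEcf_standardize hn0 (fun k : Fin n => X k _) μ hσ] using hn

/-- True also at `n = 0`, where both sides are `0`. -/
lemma natCast_rpow_neg_half (n : ℕ) : (n : ℝ) ^ (-(1 / 2) : ℝ) = 1 / √(n : ℝ) := by
  rw [Real.rpow_neg (Nat.cast_nonneg n), ← Real.sqrt_eq_rpow, one_div]

end SelfSimilarityTest

theorem mainTheorem5 {Ω : Type*} [MeasurableSpace Ω] (P : Measure Ω) [IsProbabilityMeasure P]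
    (μ σ : ℝ) (hσ : 0 < σ) (T : ℝ) (hT : 0 < T) (M : ℕ)
    (X : ℕ → Ω → ℝ) (hX : ∀ k, Measurable (X k)) (hindep : iIndepFun X P)
    (hlaw : ∀ k, HasLaw (X k) (gaussianReal μ ⟨σ ^ 2, sq_nonneg σ⟩) P) :
    ∀ m ∈ Finset.Icc 1 M,
      (∃ r : ℕ → Ω → C(Set.Icc (-T) T, ℂ),
        (∀ n, StronglyMeasurable (r n)) ∧
        (∀ n, 1 ≤ n → ∀ ω, ∀ t : Set.Icc (-T) T,
          SelfSimilarityTest.discrepancy m (fun k : Fin n => X k ω) t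
            = SelfSimilarityTest.psi0 t / (√(n : ℝ) : ℂ)
                * SelfSimilarityTest.transformedDeviation m (fun k : Fin n => X k ω) t
              + r n ω t) ∧
        SelfSimilarityTest.IsLittleOP P (fun n ω => ‖r n ω‖)
          (fun n => (n : ℝ) ^ (-(1 / 2) : ℝ)) ∧
        (∀ p : ℝ, 1 ≤ p →
          UniformIntegrable (fun (n : ℕ+) ω => ‖r n ω‖ ^ p) 1 P)) ∧
      SelfSimilarityTest.IsBigOP P
        (fun n ω => ‖(SelfSimilarityTest.discrepancy m (fun k : Fin n => X k ω)).restrict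
          (Set.Icc (-T) T)‖)
        (fun n => (n : ℝ) ^ (-(1 / 2) : ℝ)) := by
  open SelfSimilarityTest in
  intro m hm
  have hm0 : m ≠ 0 := by
    have := (Finset.mem_Icc.1 hm).1
    omega
  have hmeas : ∀ n : ℕ, StronglyMeasurable fun ω =>
      discrepancyRemainder T m fun k : Fin n => X k ω := fun n =>
    stronglyMeasurable_discrepancyRemainder T m fun k => hX k
  refine ⟨⟨fun n ω => discrepancyRemainder T m fun k : Fin n => X k ω, hmeas, ?_, ?_, ?_⟩, ?_⟩
  · intro n hn ω t
    exact discrepancy_eq (by omega) hm0 _ t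
  · rw [IsLittleOP, tendstoInMeasure_iff_norm]
    intro η hη
    rw [ENNReal.tendsto_nhds_zero]
    intro ε' hε'
    -- The tolerance `ε'` may be infinite, so a positive real below it is used.
    obtain ⟨ε, -, hε0, hεε⟩ := ENNReal.lt_iff_exists_real_btwn.1 hε'
    obtain ⟨C, hC, hbound⟩ := exists_measure_stdEcf_sub_psi0_le_of_gaussianReal hσ hX hindep hlaw
      hT (ENNReal.ofReal_pos.1 hε0)
    set B : ℝ := (((m : ℝ) + 1) ^ 2 + m ^ 2) * C ^ 2 with hB
    have hlim : Tendsto (fun n : ℕ => B / √(n : ℝ)) atTop (𝓝 0) :=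
      (Real.tendsto_sqrt_atTop.comp tendsto_natCast_atTop_atTop).const_div_atTop B
    filter_upwards [hbound, hlim.eventually (eventually_lt_nhds hη), eventually_ne_atTop 0]
      with n hn hsmall hn0
    refine (measure_mono fun ω hω => ?_).trans (hn.trans hεε.le)
    intro hall
    have hs : 0 < √(n : ℝ) := Real.sqrt_pos.2 (by positivity)
    have h1 := norm_discrepancyRemainder_le m _ hall
    rw [Set.mem_ofPred_eq, natCast_rpow_neg_half, sub_zero, div_div_eq_mul_div, div_one,
      Real.norm_of_nonneg (by positivity)] at hω
    -- The squared rate `C² / n` leaves `B / √n` after multiplication by `√n`, eventually below `η`.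
    have h2 : ‖discrepancyRemainder T m fun k : Fin n => X k ω‖ * √(n : ℝ) ≤ B / √(n : ℝ) := by
      calc _ ≤ (((m : ℝ) + 1) ^ 2 + m ^ 2) * (C / √(n : ℝ)) ^ 2 * √(n : ℝ) := by gcongr
        _ = B / √(n : ℝ) := by
          rw [hB]
          field_simp
    linarith
  · intro p hp
    refine uniformIntegrable_of_norm_le (B := ((((m : ℝ) + 1) ^ 2 + m ^ 2) * 2 ^ 2) ^ p)
      (fun n => ?_) fun n ω => ?_
    · exact ((hmeas n).norm.measurable.pow_const p).aestronglyMeasurable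
    · rw [Real.norm_of_nonneg (by positivity)]
      exact Real.rpow_le_rpow (norm_nonneg _) (norm_discrepancyRemainder_le_const T m _)
        (by linarith)
  · intro ε hε
    obtain ⟨C, hC, hbound⟩ := exists_measure_stdEcf_sub_psi0_le_of_gaussianReal hσ hX hindep hlaw
      hT hε
    refine ⟨(2 * m + 1) * C, by positivity, ?_⟩
    filter_upwards [hbound] with n hn
    refine (measure_mono fun ω hω => ?_).trans hn
    intro hall
    have h1 := norm_discrepancy_restrict_le (by positivity) hm0 _ hall
    rw [Set.mem_ofPred_eq, natCast_rpow_neg_half, abs_of_nonneg (by positivity), abs_norm,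
      mul_one_div, mul_div_assoc] at hω
    linarith
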